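/- Let $n\ge 1$. Put $\xi(s)=\frac12 s(s-1)\pi^{-s/2}\Gamma(\frac s2)\zeta(s)$, $\Xi(t)=\xi(\frac12+it)$ for $t\in\mathbb R$, and $\psi(x)=\sum_{m=1}^{\infty}e^{-\pi m^2x}$ for $x>0$. On $\mathbb R^n$ let $$g(x)=\prod_{l=1}^{n}\frac{\Xi(x_l)}{x_l^2+\frac14},\qquad K(x)=\frac{\Gamma(\frac{n+1}{2})}{\pi^{\frac{n+1}{2}}(1+|x|^2)^{\frac{n+1}{2}}},\qquad K_y(x)=y^{-n}K(y^{-1}x)\quad(y>0).$$ Then the convolution $u(x,y)=(g*K_y)(x)=\int_{\mathbb R^n}g(t)K_y(x-t)\,dt$ converges absolutely for all $x\in\mathbb R^n$ and $y>0$, and it solves the Dirichlet problem $$\partial_y^2u+\sum_{l=1}^n\partial_l^2u=0\ \text{ on }\ \mathbb R^n\times(0,\infty),\qquad u(x,0)=g(x);$$ that is, $u$ is $C^2$ and satisfies the equation for $y>0$, and $u(x',y)\to g(x)$ as $(x',y)\to(x,0)$ with $y>0$, for every $x\in\mathbb R^n$. Furthermore, for every $y>0$, $$u(0,y)=(g*K_y)(0)=\frac1{2^{n}}\int_{\mathbb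 R^n}e^{-|yz|}\prod_{l=1}^{n}\left(e^{z_l/2}-2e^{-z_l/2}\psi(e^{-2z_l})\right)dz,$$ where the integral converges absolutely. -/

import Mathlib

open MeasureTheory Filter Topology

noncomputable section

namespace XiDirichlet

/-- The Riemann xi-function `ξ(s) = ½ s (s - 1) π^(-s/2) Γ(s/2) ζ(s)`, by its defining formula.
(It is used only on the line `Re s = 1/2`, where no factor has a pole.) -/
def xi (s : ℂ) : ℂ :=
  1 / 2 * s * (s - 1) * (Real.pi : ℂ) ^ (-s / 2) * Complex.Gamma (s / 2) * riemannZeta s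

/-- `Ξ(t) = ξ(1/2 + i t)`. -/
def bigXi (t : ℝ) : ℂ := xi (1 / 2 + Complex.I * (t : ℂ))

/-- `ψ(x) = ∑_{m ≥ 1} exp (-π m² x)` (for `x > 0`). -/
def psi (x : ℝ) : ℝ := ∑' m : ℕ, Real.exp (-Real.pi * ((m : ℝ) + 1) ^ 2 * x)

/-- The boundary datum `g(x) = ∏_l Ξ(x_l) / (x_l² + 1/4)` on `ℝⁿ`. -/
def datum {n : ℕ} (x : EuclideanSpace ℝ (Fin n)) : ℂ :=
  ∏ l : Fin n, bigXi (x l) / (((x l) ^ 2 + 1 / 4 : ℝ) : ℂ)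

/-- `K(x) = Γ((n+1)/2) / (π^((n+1)/2) (1 + |x|²)^((n+1)/2))` on `ℝⁿ`. -/
def kernel {n : ℕ} (x : EuclideanSpace ℝ (Fin n)) : ℝ :=
  Real.Gamma (((n : ℝ) + 1) / 2) /
    (Real.pi ^ (((n : ℝ) + 1) / 2) * (1 + ‖x‖ ^ 2) ^ (((n : ℝ) + 1) / 2))

/-- The Poisson kernel of the upper half-space, `K_y(x) = y^(-n) K(y⁻¹ x)`, for `y > 0`,
regarded as complex valued. -/
def poissonK {n : ℕ} (y : ℝ) (x : EuclideanSpace ℝ (Fin n)) : ℂ :=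
  (((y ^ n)⁻¹ * kernel (y⁻¹ • x) : ℝ) : ℂ)

/-- The convolution `u(x, y) = (g * K_y)(x) = ∫ g(t) K_y(x - t) dt`, for `y > 0`. -/
def harmonicExt {n : ℕ} (x : EuclideanSpace ℝ (Fin n)) (y : ℝ) : ℂ :=
  convolution datum (poissonK y) (ContinuousLinearMap.mul ℝ ℂ) volume x

/-- `u` is a classical solution of the Dirichlet problem in the upper half-space
`{(x, y) | x ∈ ℝⁿ, y > 0}` with boundary values `g`: it is `C²` there, satisfies
`∂_y² u + ∑_l ∂_l² u = 0` there, and `u(x', y) → g(x)` as `(x', y) → (x, 0)` inside the half-space,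
for every `x`. Values of `u` for `y ≤ 0` play no role. -/
structure SolvesDirichlet {n : ℕ} (u : EuclideanSpace ℝ (Fin n) → ℝ → ℂ)
    (g : EuclideanSpace ℝ (Fin n) → ℂ) : Prop where
  contDiffOn : ContDiffOn ℝ 2 (fun p : EuclideanSpace ℝ (Fin n) × ℝ => u p.1 p.2) {p | 0 < p.2}
  laplace : ∀ (x : EuclideanSpace ℝ (Fin n)) (y : ℝ), 0 < y →
    iteratedDeriv 2 (fun t : ℝ => u x t) y +
      ∑ l : Fin n, iteratedDeriv 2 (fun t : ℝ => u (x + t • EuclideanSpace.single l (1 : ℝ)) y) 0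
      = 0
  boundary : ∀ x : EuclideanSpace ℝ (Fin n),
    Tendsto (fun p : EuclideanSpace ℝ (Fin n) × ℝ => u p.1 p.2)
      (𝓝[{p | 0 < p.2}] (x, (0 : ℝ))) (𝓝 (g x))

/-- The integrand `exp (-|y z|) ∏_l (e^(z_l/2) - 2 e^(-z_l/2) ψ(e^(-2 z_l)))`, `z ∈ ℝⁿ`. -/
def thetaIntegrand {n : ℕ} (y : ℝ) (z : EuclideanSpace ℝ (Fin n)) : ℝ :=
  Real.exp (-‖y • z‖) *
    ∏ l : Fin n, (Real.exp (z l / 2) - 2 * Real.exp (-(z l) / 2) * psi (Real.exp (-2 * z l)))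

end XiDirichlet

end

/-! On the critical line `s (s - 1) = -(t² + 1/4)`, so each factor of `g` is minus half the
completed zeta function at `1/2 + it`. That function is a Mellin transform of the theta series with
both of its leading terms removed; the substitution `x = e^(-2z)` makes it a Fourier transform, and
`g` becomes `2^(-n)` times the Fourier transform of an L¹ product of theta factors (`datum_factor`,
`datum_eq_poissonTransform`).

The Poisson kernel `K_y` has Fourier transform `e^(-y|z|)`, by Gaussian superposition and
subordination. Fubini then gives `u(x, y) = 2^(-n) ∫ e^(-y|z| - i⟨z, x⟩) ∏ thetaFactor(z_l) dz`
(`harmonicExt_eq_poissonTransform`). Each exponential is harmonic, since `|z|² - ∑ z_l² = 0`, and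
differentiation under the integral is legitimate for `y > 0`. Dominated convergence gives the
boundary values, and `x = 0` gives the theta integral. -/

namespace XiDirichlet

/-! ### The completed zeta function on the critical line as a Fourier transform -/

section ThetaFactor

open Complex HurwitzZeta Set

lemma evenKernel_zero_eq_one_add_psi {x : ℝ} (hx : 0 < x) :
    evenKernel 0 x = 1 + 2 * psi x := by
  have h := hasSum_int_evenKernel 0 hx
  -- Pairing `m` with `-m` counts the index 0 twice; the next line drops that pair, leaving
  -- `evenKernel 0 x - 1`.
  have h1 := h.nat_add_neg
  have h2 := (hasSum_nat_add_iff' 1).2 h1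
  simp only [QuotientAddGroup.mk_zero] at h2
  have h3 : HasSum (fun m : ℕ => Real.exp (-Real.pi * ((m : ℝ) + 1) ^ 2 * x))
      ((evenKernel 0 x - 1) / 2) := by
    convert! h2.div_const 2 using 1
    · ext m
      push_cast
      simp only [add_zero, neg_sq]
      ring_nf
    · simp
  rw [psi, h3.tsum_eq]
  ring

/-- `θ(x) - 1 - x^(-1/2)`, whose Mellin transform represents the completed zeta function inside
the critical strip. -/
noncomputable def thetaRemainder (x : ℝ) : ℂ := (evenKernel 0 x : ℂ) - 1 - (x : ℂ) ^ (-(1 / 2) : ℂ)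

/-- `f_modif` subtracts only `x^(-1/2)` on `(0, 1)` and only `1` on `(1, ∞)`. Subtracting the other
term on each piece contributes `-1/s` and `-1/(1/2 - s)`, exactly the polar terms that separate `Λ`
from `Λ₀`. The two integrals converge precisely for `0 < Re s < 1/2`. -/
lemma hasMellin_thetaRemainder {s : ℂ} (h0 : 0 < s.re) (h1 : s.re < 1 / 2) :
    HasMellin thetaRemainder s ((hurwitzEvenFEPair 0).Λ s) := by
  set P := hurwitzEvenFEPair 0 with hP
  have hm : MellinConvergent P.f_modif s := (P.isStrongFEPair_toStrongFEPair.hasMellin s).1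
  have hone := hasMellin_one_Ioc h0
  have hre : (s - 3 / 2).re < -1 := by
    simp only [sub_re, div_ofNat_re, re_ofNat]; linarith
  have htail_eq : EqOn (fun t : ℝ => (t : ℂ) ^ (s - 1) •
      indicator (Ioi 1) (fun t : ℝ => (t : ℂ) ^ (-(1 / 2) : ℂ)) t)
      (indicator (Ioi 1) (fun t : ℝ => (t : ℂ) ^ (s - 3 / 2))) (Ioi 0) := by
    intro t ht
    by_cases h : t ∈ Ioi (1 : ℝ)
    · have ht0 : (t : ℂ) ≠ 0 := ofReal_ne_zero.2 (ne_of_gt ht)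
      simp only [indicator_of_mem h, smul_eq_mul, ← cpow_add _ _ ht0]
      congr 1; ring
    · simp [indicator_of_notMem h]
  have hsub : Ioi (1 : ℝ) ⊆ Ioi 0 := Ioi_subset_Ioi zero_le_one
  have htail : HasMellin (indicator (Ioi 1) (fun t : ℝ => (t : ℂ) ^ (-(1 / 2) : ℂ))) s
      (1 / (1 / 2 - s)) := by
    constructor
    · rw [MellinConvergent, integrableOn_congr_fun htail_eq measurableSet_Ioi, IntegrableOn,
        integrable_indicator_iff measurableSet_Ioi, IntegrableOn,
        Measure.restrict_restrict measurableSet_Ioi, inter_eq_left.2 hsub]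
      exact integrableOn_Ioi_cpow_of_lt hre one_pos
    · rw [mellin, setIntegral_congr_fun measurableSet_Ioi htail_eq,
        setIntegral_indicator measurableSet_Ioi, inter_eq_right.2 hsub,
        integral_Ioi_cpow_of_lt hre one_pos]
      have : (1 / 2 - s : ℂ) ≠ 0 := by
        intro h
        have := congrArg re h
        simp at this; linarith
      have h' : (s - 3 / 2 + 1 : ℂ) ≠ 0 := by
        intro h; apply this; linear_combination -h
      rw [ofReal_one, one_cpow, div_eq_div_iff h' this]
      ring
  have hsub1 := hasMellin_sub hm hone.1
  have hsub2 := hasMellin_sub hsub1.1 htail.1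
  have heq : (fun t : ℝ => (t : ℂ) ^ (s - 1) • (P.f_modif t - indicator (Ioc 0 1) (fun _ => 1) t -
      indicator (Ioi 1) (fun t : ℝ => (t : ℂ) ^ (-(1 / 2) : ℂ)) t)) =ᵐ[volume.restrict (Ioi 0)]
      (fun t : ℝ => (t : ℂ) ^ (s - 1) • thetaRemainder t) := by
    -- At `t = 1` the function `f_modif` is zero by convention, so the identity holds only almost
    -- everywhere.
    have hne : ∀ᵐ t : ℝ ∂volume.restrict (Ioi 0), t ≠ 1 :=
      ae_restrict_of_ae (Measure.ae_ne volume 1)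
    filter_upwards [hne, ae_restrict_mem measurableSet_Ioi] with t ht1 ht0
    have ht0' : 0 < t := ht0
    congr 1
    rcases lt_or_gt_of_ne ht1 with h | h
    · have a1 : t ∉ Ioi (1 : ℝ) := notMem_Ioi.2 h.le
      have a2 : t ∈ Ioo (0 : ℝ) 1 := ⟨ht0, h⟩
      have a3 : t ∈ Ioc (0 : ℝ) 1 := ⟨ht0, h.le⟩
      simp only [WeakFEPair.f_modif, Pi.add_apply, indicator_of_notMem a1, indicator_of_mem a2,
        indicator_of_mem a3, hP, hurwitzEvenFEPair, thetaRemainder, Function.comp]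
      rw [ofReal_cpow ht0'.le]
      push_cast
      simp only [smul_eq_mul]
      ring
    · have a1 : t ∈ Ioi (1 : ℝ) := h
      have a2 : t ∉ Ioo (0 : ℝ) 1 := fun h' => absurd h'.2 (not_lt.2 h.le)
      have a3 : t ∉ Ioc (0 : ℝ) 1 := fun h' => absurd h'.2 (not_le.2 h)
      simp only [WeakFEPair.f_modif, Pi.add_apply, indicator_of_mem a1, indicator_of_notMem a2,
        indicator_of_notMem a3, hP, hurwitzEvenFEPair, thetaRemainder, Function.comp, if_true]
      ring
  refine ⟨hsub2.1.congr heq, ?_⟩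
  rw [mellin, ← integral_congr_ae heq]
  refine hsub2.2.trans ?_
  rw [hsub1.2, hone.2, htail.2, WeakFEPair.Λ, WeakFEPair.Λ₀]
  simp [hP, hurwitzEvenFEPair]

/-- The one-dimensional factor `e^(z/2) - 2 e^(-z/2) ψ(e^(-2z))` of the theta integrand. -/
noncomputable def thetaFactor (z : ℝ) : ℝ :=
  Real.exp (z / 2) - 2 * Real.exp (-z / 2) * psi (Real.exp (-2 * z))

lemma thetaRemainder_exp (z : ℝ) :
    thetaRemainder (Real.exp (-2 * z)) = -Real.exp (z / 2) * thetaFactor z := by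
  have h : ((Real.exp (-2 * z) : ℝ) : ℂ) ^ (-(1 / 2) : ℂ) = ((Real.exp z : ℝ) : ℂ) := by
    rw [cpow_def_of_ne_zero (by exact_mod_cast (Real.exp_pos _).ne'), ← ofReal_log
      (Real.exp_pos _).le, Real.log_exp]
    push_cast
    congr 1; ring
  rw [thetaRemainder, h, evenKernel_zero_eq_one_add_psi (Real.exp_pos _), thetaFactor]
  have h1 : Real.exp z = Real.exp (z / 2) * Real.exp (z / 2) := by
    rw [← Real.exp_add]; congr 1; ring
  have h2 : Real.exp (z / 2) * Real.exp (-z / 2) = 1 := by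
    rw [← Real.exp_add]; simp; ring
  rw [h1]
  push_cast
  have h2' : cexp (z / 2) * cexp (-z / 2) = 1 := by exact_mod_cast congrArg ofReal h2
  linear_combination (-2 * (psi (Real.exp (-2 * z)) : ℂ)) * h2'

lemma image_exp_neg_two_mul : (fun z : ℝ => Real.exp (-2 * z)) '' univ = Ioi 0 := by
  ext x
  simp only [image_univ, mem_range, mem_Ioi]
  refine ⟨?_, fun hx => ⟨-(Real.log x) / 2, ?_⟩⟩
  · rintro ⟨z, rfl⟩; exact Real.exp_pos _
  · rw [show -2 * (-(Real.log x) / 2) = Real.log x by ring, Real.exp_log hx]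

/-- Substitute `x = e^(-2z)` in the Mellin integral at `s/2`, `s = 1/2 + it`, whose real part `1/4`
lies in the strip. The factor `e^(z/2)` from `thetaRemainder_exp` cancels the real part of the
exponent. Integrability comes from Mellin convergence, so no decay estimate for `psi` is needed. -/
lemma thetaFactor_fourier (t : ℝ) :
    Integrable (fun z : ℝ => cexp (-(I * t * z)) * thetaFactor z) ∧
    ∫ z : ℝ, cexp (-(I * t * z)) * thetaFactor z = -completedRiemannZeta (1 / 2 + I * t) := by
  have hre : ((1 / 2 + I * t) / 2 : ℂ).re = 1 / 4 := by
    simp; norm_num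
  obtain ⟨hi, hv⟩ := hasMellin_thetaRemainder (s := (1 / 2 + I * t) / 2)
    (by rw [hre]; norm_num) (by rw [hre]; norm_num)
  have hd : ∀ z ∈ (univ : Set ℝ), HasDerivWithinAt (fun z : ℝ => Real.exp (-2 * z))
      (Real.exp (-2 * z) * (-2)) univ z := by
    intro z _
    refine HasDerivAt.hasDerivWithinAt ?_
    have := ((hasDerivAt_id z).const_mul (-2 : ℝ)).exp
    simpa using this
  have hinj : InjOn (fun z : ℝ => Real.exp (-2 * z)) univ := by
    intro a _ b _ h
    have := Real.exp_injective h
    linarith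
  have key : ∀ z : ℝ, |Real.exp (-2 * z) * (-2)| • (((Real.exp (-2 * z) : ℝ) : ℂ) ^
      ((1 / 2 + I * t) / 2 - 1) • thetaRemainder (Real.exp (-2 * z))) =
      (-2 : ℂ) * (cexp (-(I * t * z)) * thetaFactor z) := by
    intro z
    rw [thetaRemainder_exp, abs_mul, abs_of_pos (Real.exp_pos _), cpow_def_of_ne_zero
      (by exact_mod_cast (Real.exp_pos _).ne'), ← ofReal_log (Real.exp_pos _).le, Real.log_exp]
    have : cexp (-(I * t * z)) = cexp (-2 * z) * cexp ((-2 * z) * ((1 / 2 + I * t) / 2 - 1)) *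
        cexp (z / 2) := by
      rw [← Complex.exp_add, ← Complex.exp_add]
      congr 1; ring
    rw [this]
    simp only [real_smul, smul_eq_mul]
    push_cast
    norm_num
    ring
  rw [MellinConvergent, ← image_exp_neg_two_mul,
    integrableOn_image_iff_integrableOn_abs_deriv_smul MeasurableSet.univ hd hinj] at hi
  rw [mellin, ← image_exp_neg_two_mul,
    integral_image_eq_integral_abs_deriv_smul MeasurableSet.univ hd hinj] at hv
  simp only [key, integrableOn_univ, Measure.restrict_univ, integral_const_mul] at hi hv
  refine ⟨?_, ?_⟩
  · simpa [← mul_assoc] using hi.const_mul (-(1 / 2) : ℂ)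
  · rw [completedRiemannZeta, completedHurwitzZetaEven, ← hv]
    ring

lemma integrable_thetaFactor : Integrable thetaFactor := by
  have h := (thetaFactor_fourier 0).1
  simpa using h.re

lemma datum_factor (t : ℝ) : bigXi t / (((t ^ 2 + 1 / 4 : ℝ)) : ℂ) =
    1 / 2 * ∫ z : ℝ, cexp (-(I * t * z)) * thetaFactor z := by
  rw [(thetaFactor_fourier t).2, bigXi, xi]
  have hs : (1 / 2 + I * t : ℂ) ≠ 0 := by
    intro h; have := congrArg re h; simp at this
  have hG : Gammaℝ (1 / 2 + I * t) ≠ 0 := Gammaℝ_ne_zero_of_re_pos (by simp)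
  rw [riemannZeta_def_of_ne_zero hs]
  rw [Gammaℝ] at hG ⊢
  have hq : ((t ^ 2 + 1 / 4 : ℝ) : ℂ) ≠ 0 := by
    exact_mod_cast (by positivity : t ^ 2 + 1 / 4 ≠ (0 : ℝ))
  have hq' : ((t ^ 2 + 1 / 4 : ℝ) : ℂ) = -((1 / 2 + I * t) * (1 / 2 + I * t - 1)) := by
    push_cast
    linear_combination (t : ℂ) ^ 2 * I_sq
  rw [div_eq_iff hq, hq']
  rw [show ∀ a b c d e f : ℂ, a * b * c * d * e * f = a * b * c * ((d * e) * f) by intros; ring,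
    mul_div_cancel₀ _ hG]
  ring

end ThetaFactor

/-! ### The subordination integral -/

section Subordination

open Complex Set

/-- Cauchy–Schlömilch: `v ↦ v - c/v` maps `(0, ∞)` bijectively onto `ℝ` with derivative `1 + c/v²`,
and `v ↦ c/v` shows that the two summands contribute equally to the Gaussian integral. -/
lemma integral_exp_neg_sq_sub_div {c : ℝ} (hc : 0 < c) :
    ∫ v in Ioi (0 : ℝ), Real.exp (-(v - c / v) ^ 2) = √Real.pi / 2 := by
  have hdF : ∀ v ∈ Ioi (0 : ℝ), HasDerivAt (fun v : ℝ => v - c / v) (1 + c / v ^ 2) v := by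
    intro v hv
    have hv' : v ≠ 0 := ne_of_gt hv
    have := (hasDerivAt_id v).sub ((hasDerivAt_const v c).div (hasDerivAt_id v) hv')
    convert! this using 1
    simp; ring
  have hdG : ∀ v ∈ Ioi (0 : ℝ), HasDerivAt (fun v : ℝ => c / v) (-(c / v ^ 2)) v := by
    intro v hv
    have hv' : v ≠ 0 := ne_of_gt hv
    have := (hasDerivAt_const v c).div (hasDerivAt_id v) hv'
    convert! this using 1
    simp; ring
  have injF : InjOn (fun v : ℝ => v - c / v) (Ioi 0) := by
    have : StrictMonoOn (fun v : ℝ => v - c / v) (Ioi 0) := by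
      intro a ha b hb hab
      have := div_lt_div_of_pos_left hc ha hab
      simp only; linarith
    exact this.injOn
  have injG : InjOn (fun v : ℝ => c / v) (Ioi 0) := by
    intro a ha b hb hab
    have ha' : a ≠ 0 := ne_of_gt ha
    have hb' : b ≠ 0 := ne_of_gt hb
    simp only at hab
    rw [div_eq_div_iff ha' hb'] at hab
    exact (mul_left_cancel₀ hc.ne' hab).symm
  have imF : (fun v : ℝ => v - c / v) '' Ioi 0 = univ := by
    -- The witness is the positive root of `v² - w v - c = 0`.
    refine eq_univ_of_forall fun w => ⟨(w + √(w ^ 2 + 4 * c)) / 2, ?_, ?_⟩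
    · have : |w| < √(w ^ 2 + 4 * c) := by
        rw [← Real.sqrt_sq_eq_abs]; exact Real.sqrt_lt_sqrt (sq_nonneg _) (by linarith)
      have := neg_abs_le w
      simp only [mem_Ioi]; linarith
    · have h1 : |w| < √(w ^ 2 + 4 * c) := by
        rw [← Real.sqrt_sq_eq_abs]; exact Real.sqrt_lt_sqrt (sq_nonneg _) (by linarith)
      have h2 := neg_abs_le w
      have h3 : 0 < w + √(w ^ 2 + 4 * c) := by linarith
      have h4 := Real.sq_sqrt (by positivity : 0 ≤ w ^ 2 + 4 * c)
      simp only
      field_simp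
      nlinarith
  have imG : (fun v : ℝ => c / v) '' Ioi 0 = Ioi 0 := by
    ext x
    constructor
    · rintro ⟨v, hv, rfl⟩; exact div_pos hc hv
    · intro hx
      exact ⟨c / x, div_pos hc hx, by have : x ≠ 0 := ne_of_gt hx
                                      simp only; field_simp⟩
  have gaussInt : Integrable (fun w : ℝ => Real.exp (-w ^ 2)) := by
    simpa using integrable_exp_neg_mul_sq one_pos
  have gaussVal : ∫ w : ℝ, Real.exp (-w ^ 2) = √Real.pi := by
    simpa using integral_gaussian 1
  have intF := (integrableOn_image_iff_integrableOn_abs_deriv_smul measurableSet_Ioi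
    (fun v hv => (hdF v hv).hasDerivWithinAt) injF (fun w : ℝ => Real.exp (-w ^ 2))).1
    (by rw [imF]; exact gaussInt.integrableOn)
  have valF := integral_image_eq_integral_abs_deriv_smul measurableSet_Ioi
    (fun v hv => (hdF v hv).hasDerivWithinAt) injF (fun w : ℝ => Real.exp (-w ^ 2))
  rw [imF, setIntegral_univ, gaussVal] at valF
  have valG := integral_image_eq_integral_abs_deriv_smul measurableSet_Ioi
    (fun v hv => (hdG v hv).hasDerivWithinAt) injG (fun v : ℝ => Real.exp (-(v - c / v) ^ 2))
  rw [imG] at valG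
  have meas : AEStronglyMeasurable (fun v : ℝ => Real.exp (-(v - c / v) ^ 2))
      (volume.restrict (Ioi 0)) := (by fun_prop : Measurable _).aestronglyMeasurable
  have measG : AEStronglyMeasurable (fun v : ℝ => c / v ^ 2 * Real.exp (-(v - c / v) ^ 2))
      (volume.restrict (Ioi 0)) := (by fun_prop : Measurable _).aestronglyMeasurable
  have i1 : IntegrableOn (fun v : ℝ => Real.exp (-(v - c / v) ^ 2)) (Ioi 0) := by
    refine Integrable.mono' intF meas ?_
    filter_upwards [ae_restrict_mem measurableSet_Ioi] with v hv
    have : (0 : ℝ) < v := hv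
    have h1 : 0 ≤ c / v ^ 2 := by positivity
    rw [Real.norm_of_nonneg (by positivity), abs_of_nonneg (by positivity), smul_eq_mul]
    nlinarith [Real.exp_pos (-(v - c / v) ^ 2)]
  have i2 : IntegrableOn (fun v : ℝ => c / v ^ 2 * Real.exp (-(v - c / v) ^ 2)) (Ioi 0) := by
    refine Integrable.mono' intF measG ?_
    filter_upwards [ae_restrict_mem measurableSet_Ioi] with v hv
    have : (0 : ℝ) < v := hv
    have h1 : 0 ≤ c / v ^ 2 := by positivity
    rw [Real.norm_of_nonneg (by positivity), abs_of_nonneg (by positivity), smul_eq_mul]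
    nlinarith [Real.exp_pos (-(v - c / v) ^ 2)]
  have eF : ∫ v in Ioi (0 : ℝ), |1 + c / v ^ 2| • Real.exp (-(v - c / v) ^ 2) =
      (∫ v in Ioi (0 : ℝ), Real.exp (-(v - c / v) ^ 2)) +
      ∫ v in Ioi (0 : ℝ), c / v ^ 2 * Real.exp (-(v - c / v) ^ 2) := by
    rw [← integral_add i1 i2]
    refine setIntegral_congr_fun measurableSet_Ioi fun v hv => ?_
    have : (0 : ℝ) < v := hv
    have h1 : 0 ≤ c / v ^ 2 := by positivity
    simp only [smul_eq_mul]
    rw [abs_of_nonneg (by positivity)]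
    ring
  have eG : ∫ v in Ioi (0 : ℝ), |-(c / v ^ 2)| • Real.exp (-(c / v - c / (c / v)) ^ 2) =
      ∫ v in Ioi (0 : ℝ), c / v ^ 2 * Real.exp (-(v - c / v) ^ 2) := by
    refine setIntegral_congr_fun measurableSet_Ioi fun v hv => ?_
    have hv0 : (0 : ℝ) < v := hv
    have h1 : 0 ≤ c / v ^ 2 := by positivity
    simp only [smul_eq_mul]
    rw [abs_neg, abs_of_nonneg h1, div_div_cancel₀ hc.ne', ← neg_sub v, neg_sq]
  rw [eG] at valG
  rw [eF] at valF
  linarith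

/-- The subordination identity `∫₀^∞ s^(-1/2) e^(-s - b²/(4s)) ds = √π e^(-b)`. -/
lemma integral_subordination {b : ℝ} (hb : 0 ≤ b) :
    ∫ s in Ioi (0 : ℝ), s ^ (-(1 / 2) : ℝ) * Real.exp (-s - b ^ 2 / (4 * s)) =
      √Real.pi * Real.exp (-b) := by
  rcases hb.eq_or_lt with rfl | hb
  · have := Real.integral_rpow_mul_exp_neg_mul_Ioi (a := 1 / 2) (r := 1) (by norm_num) one_pos
    rw [Real.Gamma_one_half_eq] at this
    simp only [one_div, inv_one, Real.one_rpow, one_mul] at this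
    rw [neg_zero, Real.exp_zero, mul_one, ← this]
    refine setIntegral_congr_fun measurableSet_Ioi fun v hv => ?_
    norm_num
  -- Put `s = v²` and complete the square: `v² + b²/(4v²) = (v - b/(2v))² + b`.
  · have h := integral_comp_rpow_Ioi_of_pos (E := ℝ)
      (g := fun s => s ^ (-(1 / 2) : ℝ) * Real.exp (-s - b ^ 2 / (4 * s))) (p := 2) two_pos
    rw [← h]
    have e : ∀ v ∈ Ioi (0 : ℝ), ((2 : ℝ) * v ^ ((2 : ℝ) - 1)) • ((v ^ (2 : ℝ)) ^ (-(1 / 2) : ℝ) *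
        Real.exp (-v ^ (2 : ℝ) - b ^ 2 / (4 * v ^ (2 : ℝ)))) =
        2 * Real.exp (-b) * Real.exp (-(v - (b / 2) / v) ^ 2) := by
      intro v hv
      have hv0 : (0 : ℝ) < v := hv
      rw [← Real.rpow_mul hv0.le]
      norm_num
      rw [Real.rpow_neg_one, show 2 * v * (v⁻¹ * Real.exp (-v ^ 2 - b ^ 2 / (4 * v ^ 2))) =
        2 * Real.exp (-v ^ 2 - b ^ 2 / (4 * v ^ 2)) by field_simp, mul_assoc, ← Real.exp_add]
      congr 2
      field_simp
      ring
    rw [setIntegral_congr_fun measurableSet_Ioi e, integral_const_mul,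
      integral_exp_neg_sq_sub_div (by positivity : 0 < b / 2)]
    ring

end Subordination

/-! ### Smoothness and harmonicity of superpositions of decaying exponentials -/

section PoissonTransform

open Complex Set

section SubexpIntegrable

variable {E F : Type} [NormedAddCommGroup E] [MeasurableSpace E] [NormedAddCommGroup F]

/-- Integrability against `e^(-ε|z|)` for every `ε > 0`. -/
structure SubexpIntegrable (μ : Measure E) (c : E → F) : Prop where
  aestronglyMeasurable : AEStronglyMeasurable c μ
  integrable : ∀ ε : ℝ, 0 < ε → Integrable (fun z => Real.exp (-(ε * ‖z‖)) * ‖c z‖) μ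

variable [BorelSpace E] {μ : Measure E} {c : E → F}

lemma _root_.MeasureTheory.Integrable.subexpIntegrable (hc : Integrable c μ) :
    SubexpIntegrable μ c := by
  refine ⟨hc.1, fun ε hε => hc.norm.mono' ?_ (ae_of_all _ fun z => ?_)⟩
  · exact (by fun_prop : Continuous fun z : E => Real.exp (-(ε * ‖z‖))).aestronglyMeasurable.mul
      hc.1.norm
  · rw [norm_mul, norm_norm, Real.norm_of_nonneg (Real.exp_pos _).le]
    refine mul_le_of_le_one_left (norm_nonneg _) (Real.exp_le_one_iff.2 ?_)
    have := norm_nonneg z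
    nlinarith

/-- Half of the exponential absorbs a factor `‖z‖`. The class is therefore stable under
differentiation of the transform, where each derivative costs one factor `phase z`. -/
lemma SubexpIntegrable.of_norm_le (hc : SubexpIntegrable μ c) {G : Type} [NormedAddCommGroup G]
    {d : E → G} {C : ℝ} (hd : AEStronglyMeasurable d μ) (h : ∀ z, ‖d z‖ ≤ C * ‖z‖ * ‖c z‖) :
    SubexpIntegrable μ d := by
  refine ⟨hd, fun ε hε => ?_⟩
  refine ((hc.integrable (ε / 2) (half_pos hε)).const_mul (|C| * (2 / ε))).mono' ?_
    (ae_of_all _ fun z => ?_)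
  · exact (by fun_prop : Continuous fun z : E => Real.exp (-(ε * ‖z‖))).aestronglyMeasurable.mul
      hd.norm
  · rw [norm_mul, norm_norm, Real.norm_of_nonneg (Real.exp_pos _).le]
    have h1 : ‖d z‖ ≤ |C| * ‖z‖ * ‖c z‖ := (h z).trans (by gcongr; exact le_abs_self C)
    have h2 : ‖z‖ ≤ 2 / ε * Real.exp (ε / 2 * ‖z‖) := by
      have := Real.add_one_le_exp (ε / 2 * ‖z‖)
      calc ‖z‖ = 2 / ε * (ε / 2 * ‖z‖) := by field_simp
        _ ≤ _ := by gcongr; linarith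
    have h3 : Real.exp (-(ε * ‖z‖)) * Real.exp (ε / 2 * ‖z‖) = Real.exp (-(ε / 2 * ‖z‖)) := by
      rw [← Real.exp_add]; congr 1; ring
    calc Real.exp (-(ε * ‖z‖)) * ‖d z‖
        ≤ Real.exp (-(ε * ‖z‖)) * (|C| * (2 / ε * Real.exp (ε / 2 * ‖z‖)) * ‖c z‖) := by
          gcongr; exact h1.trans (by gcongr)
      _ = |C| * (2 / ε) * ((Real.exp (-(ε * ‖z‖)) * Real.exp (ε / 2 * ‖z‖)) * ‖c z‖) := by ring
      _ = _ := by rw [h3]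

end SubexpIntegrable

section FourierLaplace

variable {E : Type} [NormedAddCommGroup E] [InnerProductSpace ℝ E]

/-- The linear form `(x, y) ↦ -y |z| - i ⟨z, x⟩`. -/
noncomputable def phase (z : E) : E × ℝ →L[ℝ] ℂ :=
  -(‖z‖ • (ofRealCLM.comp (ContinuousLinearMap.snd ℝ E ℝ))) -
    I • (ofRealCLM.comp ((innerSL ℝ z).comp (ContinuousLinearMap.fst ℝ E ℝ)))

lemma phase_apply (z : E) (p : E × ℝ) :
    phase z p = -(‖z‖ * p.2) - I * (inner ℝ z p.1 : ℝ) := by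
  simp [phase]

lemma continuous_phase : Continuous (phase : E → E × ℝ →L[ℝ] ℂ) := by
  unfold phase
  refine Continuous.sub (Continuous.neg ?_) ?_
  · exact continuous_norm.smul continuous_const
  · refine Continuous.const_smul ?_ I
    exact continuous_const.clm_comp ((innerSL ℝ).continuous.clm_comp continuous_const)

lemma norm_phase_le (z : E) : ‖phase z‖ ≤ 2 * ‖z‖ := by
  refine ContinuousLinearMap.opNorm_le_bound _ (by positivity) fun p => ?_
  rw [phase_apply]
  refine (norm_sub_le _ _).trans ?_
  have h1 : ‖(-(‖z‖ * p.2) : ℂ)‖ ≤ ‖z‖ * ‖p‖ := by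
    rw [norm_neg, norm_mul, norm_real, norm_norm, norm_real]
    gcongr
    exact norm_snd_le p
  have h2 : ‖I * (inner ℝ z p.1 : ℝ)‖ ≤ ‖z‖ * ‖p‖ := by
    rw [norm_mul, norm_I, one_mul, norm_real]
    refine (norm_inner_le_norm z p.1).trans ?_
    gcongr
    exact norm_fst_le p
  linarith

lemma norm_exp_phase (z : E) (p : E × ℝ) : ‖cexp (phase z p)‖ = Real.exp (-(p.2 * ‖z‖)) := by
  rw [norm_exp, phase_apply]
  simp [mul_comm]

variable [MeasurableSpace E] [BorelSpace E]

/-- The transform `p = (x, y) ↦ ∫ exp (-y |z| - i ⟨z, x⟩) c(z) dz`. -/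
noncomputable def poissonTransform {F : Type} [NormedAddCommGroup F] [NormedSpace ℂ F]
    (μ : Measure E) (c : E → F) (p : E × ℝ) : F :=
  ∫ z, cexp (phase z p) • c z ∂μ

variable {F : Type} [NormedAddCommGroup F] [NormedSpace ℂ F] {μ : Measure E} {c : E → F}

lemma SubexpIntegrable.aestronglyMeasurable_exp (hc : SubexpIntegrable μ c) (p : E × ℝ) :
    AEStronglyMeasurable (fun z => cexp (phase z p) • c z) μ :=
  (Complex.continuous_exp.comp
    (continuous_phase.clm_apply continuous_const)).aestronglyMeasurable.smul
      hc.aestronglyMeasurable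

lemma SubexpIntegrable.integrable_exp (hc : SubexpIntegrable μ c) {p : E × ℝ} (hp : 0 < p.2) :
    Integrable (fun z => cexp (phase z p) • c z) μ := by
  refine (hc.integrable p.2 hp).mono' (hc.aestronglyMeasurable_exp p) (ae_of_all _ fun z => ?_)
  rw [norm_smul, norm_exp_phase]

lemma SubexpIntegrable.smul_phase (hc : SubexpIntegrable μ c) (v : E × ℝ) :
    SubexpIntegrable μ (fun z => phase z v • c z) := by
  refine hc.of_norm_le (C := 2 * ‖v‖) ?_ fun z => ?_
  · exact (continuous_phase.clm_apply continuous_const).aestronglyMeasurable.smul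
      hc.aestronglyMeasurable
  · rw [norm_smul]
    gcongr
    refine ((phase z).le_opNorm v).trans ?_
    have := norm_phase_le z
    nlinarith [norm_nonneg v]

variable [SecondCountableTopology E]

/-- The coefficient `c(z) ⊗ phase z` of the derivative of the Poisson transform. -/
noncomputable def derivCoeff (c : E → F) (z : E) : E × ℝ →L[ℝ] F :=
  ((ContinuousLinearMap.lsmul ℝ ℂ).flip (c z)).comp (phase z)

lemma SubexpIntegrable.derivCoeff (hc : SubexpIntegrable μ c) :
    SubexpIntegrable μ (derivCoeff c) := by
  refine hc.of_norm_le (C := 2) ?_ fun z => ?_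
  · exact (continuous_fst.clm_comp continuous_snd).comp_aestronglyMeasurable
      ((((ContinuousLinearMap.lsmul ℝ ℂ).flip : F →L[ℝ] ℂ →L[ℝ] F).continuous
        |>.comp_aestronglyMeasurable hc.aestronglyMeasurable).prodMk
        (continuous_phase.comp_aestronglyMeasurable aestronglyMeasurable_id))
  · refine ContinuousLinearMap.opNorm_le_bound _ (by positivity) fun v => ?_
    simp only [XiDirichlet.derivCoeff, ContinuousLinearMap.comp_apply,
      ContinuousLinearMap.flip_apply, ContinuousLinearMap.lsmul_apply, norm_smul]
    rw [mul_right_comm]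
    gcongr
    exact (phase z).le_of_opNorm_le (norm_phase_le z) v

lemma SubexpIntegrable.hasFDerivAt (hc : SubexpIntegrable μ c) {p : E × ℝ} (hp : 0 < p.2) :
    HasFDerivAt (poissonTransform μ c) (poissonTransform μ (XiDirichlet.derivCoeff c) p) p := by
  have hd := hc.derivCoeff
  -- On this neighbourhood the weight `e^(-(p.2/2)‖z‖)` dominates uniformly.
  have hs : {q : E × ℝ | p.2 / 2 < q.2} ∈ 𝓝 p :=
    (isOpen_lt continuous_const continuous_snd).mem_nhds (half_lt_self hp)
  refine hasFDerivAt_integral_of_dominated_of_fderiv_le (𝕜 := ℝ)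
    (F := fun p z => cexp (phase z p) • c z)
    (F' := fun p z => cexp (phase z p) • XiDirichlet.derivCoeff c z) hs
    (Eventually.of_forall hc.aestronglyMeasurable_exp) (hc.integrable_exp hp)
    (hd.aestronglyMeasurable_exp p) (ae_of_all _ fun z q hq => ?_)
    (hd.integrable (p.2 / 2) (half_pos hp)) (ae_of_all _ fun z q _ => ?_)
  · rw [norm_smul, norm_exp_phase]
    have : p.2 / 2 < q.2 := hq
    gcongr
  · have h1 : HasFDerivAt (fun q => cexp (phase z q)) (cexp (phase z q) • phase z) q :=
      (phase z).hasFDerivAt.cexp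
    convert! h1.smul_const (c z) using 1
    ext v <;> simp [XiDirichlet.derivCoeff, smul_smul]

/-- The derivative is again a Poisson transform, with coefficients in a space of linear maps; hence
the induction over all target spaces `F`. -/
lemma SubexpIntegrable.contDiffOn {F : Type} [NormedAddCommGroup F] [NormedSpace ℂ F] {c : E → F}
    (hc : SubexpIntegrable μ c) (k : ℕ) :
    ContDiffOn ℝ k (poissonTransform μ c) {p | 0 < p.2} := by
  have ho : IsOpen {p : E × ℝ | 0 < p.2} := isOpen_lt continuous_const continuous_snd
  induction k generalizing F with
  | zero =>
    exact contDiffOn_zero.2 fun p hp => (hc.hasFDerivAt hp).continuousAt.continuousWithinAt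
  | succ k ih =>
    push_cast
    rw [contDiffOn_succ_iff_fderiv_of_isOpen ho]
    refine ⟨fun p hp => (hc.hasFDerivAt hp).differentiableAt.differentiableWithinAt, by simp, ?_⟩
    exact (ih hc.derivCoeff).congr fun p hp => (hc.hasFDerivAt hp).fderiv

lemma SubexpIntegrable.hasDerivAt_line (hc : SubexpIntegrable μ c) {p v : E × ℝ} {t : ℝ}
    (hp : 0 < (p + t • v).2) :
    HasDerivAt (fun s : ℝ => poissonTransform μ c (p + s • v))
      (poissonTransform μ (fun z => phase z v • c z) (p + t • v)) t := by
  have h1 : HasDerivAt (fun s : ℝ => p + s • v) v t := by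
    simpa using ((hasDerivAt_id t).smul_const v).const_add p
  have h2 := (hc.hasFDerivAt hp).comp_hasDerivAt t h1
  convert! h2 using 1
  rw [poissonTransform, poissonTransform, ContinuousLinearMap.integral_apply
    (hc.derivCoeff.integrable_exp hp)]
  simp [XiDirichlet.derivCoeff]

lemma SubexpIntegrable.iteratedDeriv_two_line (hc : SubexpIntegrable μ c) {p v : E × ℝ} {t : ℝ}
    (hp : 0 < (p + t • v).2) :
    iteratedDeriv 2 (fun s : ℝ => poissonTransform μ c (p + s • v)) t =
      poissonTransform μ (fun z => (phase z v) ^ 2 • c z) (p + t • v) := by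
  rw [iteratedDeriv_succ, iteratedDeriv_one]
  have hev : ∀ᶠ s in 𝓝 t, 0 < (p + s • v).2 :=
    (isOpen_lt continuous_const (by fun_prop :
      Continuous fun s : ℝ => (p + s • v).2)).mem_nhds hp
  have : deriv (fun s : ℝ => poissonTransform μ c (p + s • v)) =ᶠ[𝓝 t]
      fun s => poissonTransform μ (fun z => phase z v • c z) (p + s • v) :=
    hev.mono fun s hs => (hc.hasDerivAt_line hs).deriv
  rw [this.deriv_eq, ((hc.smul_phase v).hasDerivAt_line hp).deriv]
  simp only [smul_smul, sq]

end FourierLaplace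

section Euclidean

variable {n : ℕ} {μ : Measure (EuclideanSpace ℝ (Fin n))} {c : EuclideanSpace ℝ (Fin n) → ℂ}

/-- The second derivatives multiply the coefficient by `|z|²` in the direction `y` and by `(-i z_l)²
= -z_l²` in the direction `l`; these sum to zero. -/
lemma SubexpIntegrable.laplace (hc : SubexpIntegrable μ c) (x : EuclideanSpace ℝ (Fin n)) {y : ℝ}
    (hy : 0 < y) :
    iteratedDeriv 2 (fun t : ℝ => poissonTransform μ c (x, t)) y +
      ∑ l : Fin n, iteratedDeriv 2 (fun t : ℝ =>
        poissonTransform μ c (x + t • EuclideanSpace.single l (1 : ℝ), y)) 0 = 0 := by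
  have h1 : iteratedDeriv 2 (fun t : ℝ => poissonTransform μ c (x, t)) y =
      poissonTransform μ (fun z => (phase z (0, 1)) ^ 2 • c z) (x, y) := by
    have := hc.iteratedDeriv_two_line (p := (x, 0)) (v := (0, 1)) (t := y) (by simpa using hy)
    simpa using this
  have h2 : ∀ l : Fin n, iteratedDeriv 2 (fun t : ℝ =>
        poissonTransform μ c (x + t • EuclideanSpace.single l (1 : ℝ), y)) 0 =
      poissonTransform μ (fun z => (phase z (EuclideanSpace.single l 1, 0)) ^ 2 • c z) (x, y) := by
    intro l
    have := hc.iteratedDeriv_two_line (p := (x, y)) (v := (EuclideanSpace.single l 1, 0)) (t := 0)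
      (by simpa using hy)
    simpa using this
  have hi : ∀ v, Integrable (fun z => cexp (phase z (x, y)) • ((phase z v) ^ 2 • c z)) μ := by
    intro v
    have := ((hc.smul_phase v).smul_phase v).integrable_exp (p := (x, y)) hy
    simpa only [sq, smul_smul] using this
  rw [h1]
  simp only [h2]
  simp only [poissonTransform]
  rw [← integral_finsetSum _ (fun l _ => hi _), ← integral_add (hi _)
    (integrable_finsetSum _ fun l _ => hi _)]
  refine integral_eq_zero_of_ae (ae_of_all _ fun z => ?_)
  have hn : (‖z‖ : ℂ) ^ 2 = ∑ l, (z l : ℂ) ^ 2 := by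
    have := EuclideanSpace.real_norm_sq_eq z
    exact_mod_cast this
  simp only [phase_apply, smul_eq_mul, Pi.zero_apply, EuclideanSpace.inner_single_right]
  simp only [← mul_assoc, ← Finset.sum_mul, ← Finset.mul_sum]
  simp [mul_pow, hn]

end Euclidean

end PoissonTransform

section Dirichlet

open Complex Set

/-! ### The Fourier transform of the Poisson kernel -/

section PoissonKernel

variable {n : ℕ}

lemma kernel_eq_mul_rpow (x : EuclideanSpace ℝ (Fin n)) :
    kernel x = Real.Gamma (((n : ℝ) + 1) / 2) / Real.pi ^ (((n : ℝ) + 1) / 2) *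
      (1 + ‖x‖ ^ 2) ^ (-((n : ℝ) + 1) / 2) := by
  rw [kernel, neg_div, Real.rpow_neg (by positivity)]
  field_simp

lemma integrable_kernel : Integrable (kernel (n := n)) := by
  have h := (integrable_rpow_neg_one_add_norm_sq (E := EuclideanSpace ℝ (Fin n)) (μ := volume)
    (r := (n : ℝ) + 1) (by simp)).const_mul
    (Real.Gamma (((n : ℝ) + 1) / 2) / Real.pi ^ (((n : ℝ) + 1) / 2))
  exact h.congr (ae_of_all _ fun x => (kernel_eq_mul_rpow x).symm)

lemma integrable_poissonK {y : ℝ} (hy : 0 < y) : Integrable (poissonK (n := n) y) :=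
  ((integrable_kernel.comp_smul (inv_ne_zero hy.ne')).const_mul _).ofReal

/-- The kernel as a superposition of Gaussians. -/
lemma integral_gaussian_superposition (x : EuclideanSpace ℝ (Fin n)) :
    ∫ s in Ioi (0 : ℝ), s ^ (((n : ℝ) + 1) / 2 - 1) * Real.exp (-((1 + ‖x‖ ^ 2) * s)) =
      Real.pi ^ (((n : ℝ) + 1) / 2) * kernel x := by
  rw [Real.integral_rpow_mul_exp_neg_mul_Ioi (by positivity) (by positivity), kernel, one_div,
    Real.inv_rpow (by positivity)]
  field_simp

/-- The Gaussian transform contributes `s^(-n/2)`, reducing `s^((n-1)/2)` to `s^(-1/2)`, so one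
subordination identity serves every dimension. -/
lemma integral_exp_inner_mul_gaussian (z : EuclideanSpace ℝ (Fin n)) {s : ℝ} (hs : 0 < s) :
    ∫ x : EuclideanSpace ℝ (Fin n), cexp (-(I * (inner ℝ z x : ℝ))) *
      ((s ^ (((n : ℝ) + 1) / 2 - 1) * Real.exp (-((1 + ‖x‖ ^ 2) * s)) : ℝ) : ℂ) =
    ((Real.pi ^ ((n : ℝ) / 2) *
      (s ^ (-(1 / 2) : ℝ) * Real.exp (-s - ‖z‖ ^ 2 / (4 * s))) : ℝ) : ℂ) := by
  have h := GaussianFourier.integral_cexp_neg_mul_sq_norm_add (V := EuclideanSpace ℝ (Fin n))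
    (b := (s : ℂ)) (by simpa using hs) (-I) z
  have e : ∀ x : EuclideanSpace ℝ (Fin n), cexp (-(I * (inner ℝ z x : ℝ))) *
      ((s ^ (((n : ℝ) + 1) / 2 - 1) * Real.exp (-((1 + ‖x‖ ^ 2) * s)) : ℝ) : ℂ) =
      ((s ^ (((n : ℝ) + 1) / 2 - 1) * Real.exp (-s) : ℝ) : ℂ) *
        cexp (-s * ‖x‖ ^ 2 + -I * (inner ℝ z x : ℝ)) := by
    intro x
    have : -((1 + ‖x‖ ^ 2) * s) = -s + -s * ‖x‖ ^ 2 := by ring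
    rw [this, Complex.exp_add, Real.exp_add]
    push_cast
    rw [neg_mul I]
    ring
  simp only [e]
  rw [integral_const_mul, h, finrank_euclideanSpace_fin]
  have h1 : ((Real.pi : ℂ) / s) ^ ((n : ℂ) / 2) = (((Real.pi / s) ^ ((n : ℝ) / 2) : ℝ) : ℂ) := by
    rw [ofReal_cpow (by positivity)]
    push_cast
    rfl
  have h2 : cexp ((-I) ^ 2 * ‖z‖ ^ 2 / (4 * s)) = ((Real.exp (-(‖z‖ ^ 2 / (4 * s))) : ℝ) : ℂ) := by
    push_cast
    rw [neg_sq, I_sq]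
    congr 1
    ring
  rw [h1, h2, ← ofReal_mul, ← ofReal_mul]
  congr 1
  rw [Real.div_rpow Real.pi_pos.le hs.le, sub_eq_add_neg (-s), Real.exp_add]
  have h3 : s ^ (((n : ℝ) + 1) / 2 - 1) = s ^ (-(1 / 2) : ℝ) * s ^ ((n : ℝ) / 2) := by
    rw [← Real.rpow_add hs]; congr 1; ring
  rw [h3]
  have := (Real.rpow_pos_of_pos hs ((n : ℝ) / 2)).ne'
  field_simp

lemma integral_exp_inner_mul_kernel (z : EuclideanSpace ℝ (Fin n)) :
    ∫ x : EuclideanSpace ℝ (Fin n), cexp (-(I * (inner ℝ z x : ℝ))) * (kernel x : ℂ) =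
      ((Real.exp (-‖z‖) : ℝ) : ℂ) := by
  set G : EuclideanSpace ℝ (Fin n) → ℝ → ℝ := fun x s =>
    s ^ (((n : ℝ) + 1) / 2 - 1) * Real.exp (-((1 + ‖x‖ ^ 2) * s)) with hG
  have hGnn : ∀ x, ∀ s ∈ Ioi (0 : ℝ), 0 ≤ G x s := by
    intro x s hs
    have : (0 : ℝ) < s := hs
    simp only [hG]; positivity
  have hGint : ∀ x, IntegrableOn (G x) (Ioi 0) := fun x =>
    -- A non-integrable function has integral 0 by convention, so the nonzero Gamma value forces
    -- integrability.
    .of_integral_ne_zero (by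
      rw [Real.integral_rpow_mul_exp_neg_mul_Ioi (by positivity) (by positivity)]
      have := Real.Gamma_pos_of_pos (by positivity : 0 < ((n : ℝ) + 1) / 2)
      positivity)
  have hnorm : ∀ x s, ‖cexp (-(I * (inner ℝ z x : ℝ))) * (G x s : ℂ)‖ = ‖G x s‖ := by
    intro x s
    rw [norm_mul, norm_exp, norm_real]
    simp
  have hint : Integrable (Function.uncurry fun (x : EuclideanSpace ℝ (Fin n)) (s : ℝ) =>
      cexp (-(I * (inner ℝ z x : ℝ))) * (G x s : ℂ)) (volume.prod (volume.restrict (Ioi 0))) := by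
    have hm : Measurable (Function.uncurry fun (x : EuclideanSpace ℝ (Fin n)) (s : ℝ) =>
        cexp (-(I * (inner ℝ z x : ℝ))) * (G x s : ℂ)) := by
      simp only [hG, Function.uncurry_def]
      fun_prop
    refine (integrable_prod_iff hm.aestronglyMeasurable).2 ⟨ae_of_all _ fun x => ?_, ?_⟩
    · simp only [Function.uncurry_apply_pair]
      exact (Integrable.ofReal (𝕜 := ℂ) (hGint x)).const_mul _
    · simp only [Function.uncurry_apply_pair, hnorm]
      refine (integrable_kernel.const_mul (Real.pi ^ (((n : ℝ) + 1) / 2))).congr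
        (ae_of_all _ fun x => ?_)
      simp only
      rw [← integral_gaussian_superposition x]
      exact setIntegral_congr_fun measurableSet_Ioi fun s hs =>
        (Real.norm_of_nonneg (hGnn x s hs)).symm
  have hswap := integral_integral_swap hint
  have hL : ∀ x : EuclideanSpace ℝ (Fin n), ∫ s in Ioi (0 : ℝ),
      cexp (-(I * (inner ℝ z x : ℝ))) * (G x s : ℂ) =
      ((Real.pi ^ (((n : ℝ) + 1) / 2) : ℝ) : ℂ) *
        (cexp (-(I * (inner ℝ z x : ℝ))) * (kernel x : ℂ)) := by
    intro x
    rw [integral_const_mul, integral_complex_ofReal, hG, integral_gaussian_superposition x]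
    push_cast
    ring
  have hR : ∫ s in Ioi (0 : ℝ), ∫ x : EuclideanSpace ℝ (Fin n),
      cexp (-(I * (inner ℝ z x : ℝ))) * (G x s : ℂ) =
      ((Real.pi ^ (((n : ℝ) + 1) / 2) : ℝ) : ℂ) * ((Real.exp (-‖z‖) : ℝ) : ℂ) := by
    rw [setIntegral_congr_fun measurableSet_Ioi fun s hs => integral_exp_inner_mul_gaussian z hs,
      integral_complex_ofReal, integral_const_mul, integral_subordination (norm_nonneg z),
      ← ofReal_mul, Real.sqrt_eq_rpow, ← mul_assoc, ← Real.rpow_add Real.pi_pos, ← add_div]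
  simp only [hL] at hswap
  rw [integral_const_mul, hR] at hswap
  exact mul_left_cancel₀ (ofReal_ne_zero.2 (Real.rpow_pos_of_pos Real.pi_pos _).ne') hswap

lemma integral_exp_inner_mul_poissonK (z : EuclideanSpace ℝ (Fin n)) {y : ℝ} (hy : 0 < y) :
    ∫ x : EuclideanSpace ℝ (Fin n), cexp (-(I * (inner ℝ z x : ℝ))) * poissonK y x =
      ((Real.exp (-(y * ‖z‖)) : ℝ) : ℂ) := by
  have h := Measure.integral_comp_inv_smul_of_nonneg (volume : Measure (EuclideanSpace ℝ (Fin n)))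
    (fun w => cexp (-(I * (inner ℝ (y • z) w : ℝ))) * (kernel w : ℂ)) hy.le
  rw [integral_exp_inner_mul_kernel, norm_smul, Real.norm_of_nonneg hy.le,
    finrank_euclideanSpace_fin] at h
  have e : ∀ x : EuclideanSpace ℝ (Fin n), cexp (-(I * (inner ℝ z x : ℝ))) * poissonK y x =
      (((y ^ n)⁻¹ : ℝ) : ℂ) *
        (cexp (-(I * (inner ℝ (y • z) (y⁻¹ • x) : ℝ))) * (kernel (y⁻¹ • x) : ℂ)) := by
    intro x
    rw [real_inner_smul_left, real_inner_smul_right, mul_inv_cancel_left₀ hy.ne', poissonK]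
    push_cast
    ring
  simp only [e]
  rw [integral_const_mul, h, real_smul, ← mul_assoc, ← ofReal_mul, inv_mul_cancel₀ (by positivity),
    ofReal_one, one_mul]

end PoissonKernel

/-! ### The boundary datum, its Poisson extension and the Dirichlet problem -/

section Datum

variable {n : ℕ}

/-- The product `∏_l (e^(z_l/2) - 2 e^(-z_l/2) ψ(e^(-2 z_l)))`, regarded as complex valued. -/
noncomputable def thetaProd (z : EuclideanSpace ℝ (Fin n)) : ℂ :=
  ((∏ l, thetaFactor (z l) : ℝ) : ℂ)

lemma integrable_thetaProd : Integrable (thetaProd (n := n)) := by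
  have h : Integrable (fun w : Fin n → ℝ => ∏ l, thetaFactor (w l)) :=
    Integrable.fintype_prod (fun _ => integrable_thetaFactor)
  exact ((PiLp.volume_preserving_ofLp (Fin n)).integrable_comp_emb
    (MeasurableEquiv.toLp 2 (Fin n → ℝ)).symm.measurableEmbedding).2 h |>.ofReal

lemma datum_eq_poissonTransform (x : EuclideanSpace ℝ (Fin n)) :
    datum x = (1 / 2) ^ n * poissonTransform volume thetaProd (x, 0) := by
  have e : ∀ w : Fin n → ℝ, cexp (phase (WithLp.toLp 2 w) (x, 0)) • thetaProd (WithLp.toLp 2 w) =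
      ∏ l, (cexp (-(I * x l * w l)) * thetaFactor (w l)) := by
    intro w
    rw [Finset.prod_mul_distrib, ← Complex.exp_sum, phase_apply, thetaProd]
    simp only [PiLp.inner_apply, smul_eq_mul]
    push_cast
    simp [Finset.mul_sum, mul_assoc]
  rw [poissonTransform, ← (PiLp.volume_preserving_toLp (Fin n)).integral_comp
    (MeasurableEquiv.toLp 2 _).measurableEmbedding]
  simp only [e]
  rw [integral_fintype_prod_volume_eq_prod fun l (t : ℝ) =>
    cexp (-(I * x l * t)) * (thetaFactor t : ℂ)]
  simp only [datum, datum_factor, Finset.prod_mul_distrib]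
  simp

variable {E : Type} [NormedAddCommGroup E] [InnerProductSpace ℝ E] {c : E → ℂ}

lemma norm_exp_phase_smul_le {p : E × ℝ} (hp : 0 ≤ p.2) (z : E) :
    ‖cexp (phase z p) • c z‖ ≤ ‖c z‖ := by
  rw [norm_smul, norm_exp_phase]
  refine mul_le_of_le_one_left (norm_nonneg _) (Real.exp_le_one_iff.2 ?_)
  have := mul_nonneg hp (norm_nonneg z)
  linarith

variable [MeasurableSpace E] [BorelSpace E] {μ : Measure E}

lemma aestronglyMeasurable_exp_phase_smul (hc : Integrable c μ) (p : E × ℝ) :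
    AEStronglyMeasurable (fun z => cexp (phase z p) • c z) μ :=
  hc.subexpIntegrable.aestronglyMeasurable_exp p

/-- For integrable `c` the bound `‖c‖` is uniform up to `y = 0`. This yields both the continuity of
`g` and the boundary limit of `u`. -/
lemma continuousOn_poissonTransform [SecondCountableTopology E] (hc : Integrable c μ) :
    ContinuousOn (poissonTransform μ c) {p | 0 ≤ p.2} := by
  refine continuousOn_of_dominated (bound := fun z => ‖c z‖)
    (fun p _ => aestronglyMeasurable_exp_phase_smul hc p)
    (fun p hp => ae_of_all _ fun z => norm_exp_phase_smul_le hp z) hc.norm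
    (ae_of_all _ fun z => Continuous.continuousOn ?_)
  fun_prop

lemma continuous_datum : Continuous (datum (n := n)) := by
  have h := (continuousOn_poissonTransform (integrable_thetaProd (n := n))).comp_continuous
    (f := fun x => (x, 0)) (by fun_prop) (fun x => mem_ofPred.2 le_rfl)
  have : (datum (n := n)) = fun x => (1 / 2) ^ n * poissonTransform volume thetaProd (x, 0) :=
    funext datum_eq_poissonTransform
  rw [this]
  exact continuous_const.mul h

lemma norm_datum_le (x : EuclideanSpace ℝ (Fin n)) :
    ‖datum x‖ ≤ (1 / 2) ^ n * ∫ z : EuclideanSpace ℝ (Fin n), ‖thetaProd z‖ := by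
  rw [datum_eq_poissonTransform, norm_mul]
  have h1 : ‖((1 / 2) ^ n : ℂ)‖ = (1 / 2) ^ n := by simp
  rw [h1]
  gcongr
  exact norm_integral_le_of_norm_le integrable_thetaProd.norm
    (ae_of_all _ fun z => norm_exp_phase_smul_le le_rfl z)

/-- As the Fourier transform of an L¹ function, `g` is bounded and continuous, while `K_y` is
integrable. -/
lemma convolutionExists_datum_poissonK {y : ℝ} (hy : 0 < y) :
    ConvolutionExists (datum (n := n)) (poissonK y) (ContinuousLinearMap.mul ℝ ℂ) volume := by
  intro x
  have h := (integrable_poissonK (n := n) hy).comp_sub_left x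
  exact h.bdd_mul continuous_datum.aestronglyMeasurable (ae_of_all _ norm_datum_le)

/-- Characters are eigenfunctions of convolution with `K_y`. The reflection `t ↦ x - t` replaces `z`
by `-z`, which the eigenvalue `e^(-y|z|)` does not see. -/
lemma integral_exp_phase_mul_poissonK (x z : EuclideanSpace ℝ (Fin n)) {y : ℝ} (hy : 0 < y) :
    ∫ t, cexp (phase z (t, 0)) * poissonK y (x - t) = cexp (phase z (x, y)) := by
  rw [← integral_sub_left_eq_self _ volume x]
  have e : ∀ t : EuclideanSpace ℝ (Fin n), cexp (phase z (x - t, 0)) * poissonK y (x - (x - t)) =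
      cexp (-(I * (inner ℝ z x : ℝ))) *
        (cexp (-(I * (inner ℝ (-z) t : ℝ))) * poissonK y t) := by
    intro t
    rw [sub_sub_cancel, ← mul_assoc, ← Complex.exp_add, phase_apply, inner_sub_right,
      inner_neg_left]
    congr 2
    push_cast
    ring
  simp only [e]
  rw [integral_const_mul, integral_exp_inner_mul_poissonK _ hy, phase_apply, norm_neg, ofReal_exp,
    ← Complex.exp_add]
  congr 1
  push_cast
  ring

lemma harmonicExt_eq_poissonTransform (x : EuclideanSpace ℝ (Fin n)) {y : ℝ} (hy : 0 < y) :
    harmonicExt x y = (1 / 2) ^ n * poissonTransform volume thetaProd (x, y) := by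
  have hint : Integrable (Function.uncurry fun t z : EuclideanSpace ℝ (Fin n) =>
      cexp (phase z (t, 0)) * (poissonK y (x - t) * thetaProd z)) (volume.prod volume) := by
    have h := ((integrable_poissonK (n := n) hy).comp_sub_left x).mul_prod
      (integrable_thetaProd (n := n))
    refine h.bdd_mul (c := 1) ?_ (ae_of_all _ fun p => ?_)
    · refine Continuous.aestronglyMeasurable (Complex.continuous_exp.comp ?_)
      exact (continuous_phase.comp continuous_snd).clm_apply (by fun_prop)
    · rw [norm_exp_phase]; simp
  have hswap := integral_integral_swap hint
  have hL : ∀ t : EuclideanSpace ℝ (Fin n), (1 / 2) ^ n *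
      ∫ z, cexp (phase z (t, 0)) * (poissonK y (x - t) * thetaProd z) =
      datum t * poissonK y (x - t) := by
    intro t
    rw [datum_eq_poissonTransform, poissonTransform, mul_assoc, ← integral_mul_const]
    simp only [smul_eq_mul, mul_assoc, mul_comm (poissonK y (x - t))]
  have hR : ∀ z : EuclideanSpace ℝ (Fin n),
      ∫ t, cexp (phase z (t, 0)) * (poissonK y (x - t) * thetaProd z) =
      cexp (phase z (x, y)) • thetaProd z := by
    intro z
    simp only [← mul_assoc]
    rw [integral_mul_const, integral_exp_phase_mul_poissonK x z hy, smul_eq_mul]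
  rw [harmonicExt, convolution_def]
  simp only [ContinuousLinearMap.mul_apply', ← hL]
  rw [integral_const_mul, hswap]
  simp only [hR, poissonTransform]

lemma solvesDirichlet_harmonicExt : SolvesDirichlet (n := n) harmonicExt datum where
  contDiffOn := by
    have h := integrable_thetaProd (n := n) |>.subexpIntegrable.contDiffOn 2
    refine ((contDiffOn_const (c := ((1 / 2) ^ n : ℂ))).mul h).congr fun p hp => ?_
    exact harmonicExt_eq_poissonTransform p.1 hp
  laplace x y hy := by
    have h := integrable_thetaProd (n := n) |>.subexpIntegrable.laplace x hy
    -- The integral formula holds only for positive heights, so the `y`-derivative uses equality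
    -- near `y`; the `x`-derivatives stay at the fixed height `y`.
    have h1 : (fun t : ℝ => harmonicExt x t) =ᶠ[𝓝 y]
        fun t => (1 / 2) ^ n * poissonTransform volume thetaProd (x, t) :=
      (eventually_gt_nhds hy).mono fun t ht => harmonicExt_eq_poissonTransform x ht
    rw [h1.iteratedDeriv_eq]
    simp only [harmonicExt_eq_poissonTransform _ hy, iteratedDeriv_const_mul_field]
    rw [← Finset.mul_sum, ← mul_add, h, mul_zero]
  boundary x := by
    rw [datum_eq_poissonTransform]
    have h := (continuousOn_poissonTransform (integrable_thetaProd (n := n))) (x, 0)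
      (mem_ofPred.2 le_rfl)
    have h2 : Tendsto (poissonTransform volume (thetaProd (n := n))) (𝓝[{p | 0 < p.2}] (x, 0))
        (𝓝 (poissonTransform volume thetaProd (x, 0))) :=
      h.mono_left (nhdsWithin_mono _ fun p (hp : 0 < p.2) => hp.le)
    refine (h2.const_mul _).congr' ?_
    filter_upwards [self_mem_nhdsWithin] with p hp
    exact (harmonicExt_eq_poissonTransform p.1 hp).symm

lemma ofReal_thetaIntegrand {y : ℝ} (hy : 0 ≤ y) (z : EuclideanSpace ℝ (Fin n)) :
    (thetaIntegrand y z : ℂ) = cexp (phase z (0, y)) • thetaProd z := by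
  rw [phase_apply, thetaIntegrand, norm_smul, Real.norm_of_nonneg hy, thetaProd, smul_eq_mul]
  simp only [thetaFactor]
  push_cast
  simp [mul_comm (y : ℂ)]

lemma integrable_thetaIntegrand {y : ℝ} (hy : 0 < y) : Integrable (thetaIntegrand (n := n) y) := by
  have h := (integrable_thetaProd (n := n) |>.subexpIntegrable.integrable_exp
    (p := (0, y)) hy)
  simp only [← ofReal_thetaIntegrand hy.le] at h
  simpa using h.re

end Datum

end Dirichlet

end XiDirichlet

/-- The Poisson integral of `g` converges and solves the Dirichlet problem in the upper half-space
with boundary values `g`; its values on the axis `x = 0` are given by an absolutely convergent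
integral of theta type. -/
theorem theorem1p3 (n : ℕ) :
    (∀ y : ℝ, 0 < y →
      ConvolutionExists (XiDirichlet.datum (n := n)) (XiDirichlet.poissonK y)
        (ContinuousLinearMap.mul ℝ ℂ) volume) ∧
    XiDirichlet.SolvesDirichlet (n := n) XiDirichlet.harmonicExt XiDirichlet.datum ∧
    ∀ y : ℝ, 0 < y →
      Integrable (XiDirichlet.thetaIntegrand (n := n) y) ∧
      XiDirichlet.harmonicExt (0 : EuclideanSpace ℝ (Fin n)) y =
        (((1 / 2) ^ n * ∫ z : EuclideanSpace ℝ (Fin n), XiDirichlet.thetaIntegrand y z : ℝ) : ℂ) := by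
  refine ⟨fun y hy => XiDirichlet.convolutionExists_datum_poissonK hy,
    XiDirichlet.solvesDirichlet_harmonicExt,
    fun y hy => ⟨XiDirichlet.integrable_thetaIntegrand hy, ?_⟩⟩
  rw [XiDirichlet.harmonicExt_eq_poissonTransform 0 hy, XiDirichlet.poissonTransform]
  simp only [← XiDirichlet.ofReal_thetaIntegrand hy.le]
  rw [integral_complex_ofReal]
  push_cast
  rfl
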